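/- **Theorem (General correctness for total ordering).** *Setting.* Let $\mathcal N$ be a finite set of $n$ chains, and let the threshold $\Phi\in\mathbb N$ satisfy $n\ge\Phi>n/2$ or be $\Phi=2f_{max}+1$ with $f_{max}=\lfloor (n-1)/3\rfloor$. A *blocklattice* is a set of blocks $b_{j,k}$ ($j\in\mathcal N$, height $k\in\{0,1,2,\dots\}$, at most one block for each pair $(j,k)$) with an acyclic relation "acks", which contains every block acked by one of its blocks and in which every block $b_{j,k+1}$ acks $b_{j,k}$. A block *indirectly acks* another one if it does so through a chain of acks; below, "acks$^*$" means "is equal to, directly acks or indirectly acks". *Local view.* At any time a node $p$ has received a finite set of blocks and has output some of them. Let $\mathcal P_p$ be the set of blocks received but not yet output (pending), and $\mathcal C_p\subseteq\mathcal P_p$ the set of candidates, i.e. pending blocks that only ack blocks already output. Put $$ANS_p(b)=\{j:\exists k,\ b_{j,k}\in\mathcal P_p \text{ acks}^* b\},\qquad ANS_p=\bigcup_{b\in\mathcal C_p}ANS_p(b).$$ For $b\in\mathcal C_p$ let $AHV_p(b)[j]=\bot$ if $j\notin ANS_p$; otherwise let $k=\min\{i:b_{j,i}\in\mathcal P_p\}$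 and put $AHV_p(b)[j]=k$ if $b_{j,k}$ acks$^*$ $b$, and $AHV_p(b)[j]=\infty$ if not (ordered by $\bot<k<\infty$). Let $\#AHV_p(b)$ be the number of integer entries of $AHV_p(b)$ and $\ell_p(b_1,b_2)=|\{j:AHV_p(b_1)[j]<AHV_p(b_2)[j]\}|$. Put $Precede_p(b_1,b_2)=1$ if $\ell_p(b_1,b_2)>\Phi$, $-1$ if $\ell_p(b_2,b_1)>\Phi$, and $0$ otherwise. Put $Grade_p(b_1,b_2)=1$ if $Precede(b_1,b_2)=1$ in every possible future view of $p$ (arbitrary further blocks received, consistently with the old ones, and nothing further output); $Grade_p(b_1,b_2)=0$ if instead $\ell_p(b_1,b_2)<\Phi-(n-|ANS_p|)$; and $\bot$ otherwise. The preceding set is $\mathcal A_p=\{b\in\mathcal C_p: Grade_p(b',b)=0\ \ \forall b'\in\mathcal C_p\}$. *Algorithm.* The *criteria* hold at $p$ if (internal stability) for all $b\in\mathcal C_p\setminus\mathcal A_p$ there is $b'\in\mathcal A_p$ with $Grade_p(b',b)=1$; and (external stability) either (a) $|ANS_p|=n$, or (b) some $b\in\mathcal A_p$ has $\#AHV_p(b)>\Phi$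 and every $b\in\mathcal A_p$ has $|ANS_p(b)|\ge n-\Phi$. A correct node starts with nothing received and nothing output. It receives blocks of the common blocklattice one at a time, in any order and with any delays, each block after all the blocks that it acks. It outputs sets only when the criteria hold, and the set that it then outputs is $\mathcal A_p$. *Claim.* Let $p$ and $q$ be two correct nodes running this algorithm on the same blocklattice, and let $\mathcal A_p^i$ and $\mathcal A_q^i$ be the $i$-th sets that they output. Then $\mathcal A_p^i=\mathcal A_q^i$, for every $i$ for which both nodes have output an $i$-th set. -/

import Mathlib

namespace DEXON

/-- The block `b_{j,k}` is named by its chain `j` and its height `k` (heights start at `0`).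
Since every single chain is agreed upon, there is at most one block with a given name. -/
abbrev Block (ι : Type*) := ι × ℕ

/-- A set of blocks with their acking information: `acks b c` says that the block `b` directly
acks the block `c`.  Only the acks of blocks in `blocks` are meaningful. -/
structure BlockGraph (ι : Type*) where
  blocks : Set (Block ι)
  acks : Block ι → Block ι → Prop

/-- The graph is a (possibly partial) blocklattice: it contains every block acked by one of its
blocks, each block of positive height acks its predecessor in its own chain, and there is no
cycle of acks. -/
structure BlockGraph.IsBlocklattice {ι : Type*} (G : BlockGraph ι) : Prop where
  acks_mem : ∀ b ∈ G.blocks, ∀ c, G.acks b c → c ∈ G.blocks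
  acks_pred : ∀ (j : ι) (k : ℕ), (j, k + 1) ∈ G.blocks → G.acks (j, k + 1) (j, k)
  acyclic : ∀ b ∈ G.blocks, ¬ Relation.TransGen G.acks b b

/-- The local view of a node: the graph of the received blocks, and the set of those
blocks that the node has already output. -/
structure View (ι : Type*) extends BlockGraph ι where
  delivered : Set (Block ι)

namespace View

variable {ι : Type*}

/-- The pending set `P`: received and not yet output. -/
def pending (V : View ι) : Set (Block ι) := V.blocks \ V.delivered

/-- `b` acks `c` directly or indirectly, where a block counts as acking itself. -/
def AcksStar (V : View ι) (b c : Block ι) : Prop := Relation.ReflTransGen V.acks b c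

/-- The candidate set `C`: pending blocks that only ack blocks already output. -/
def candidates (V : View ι) : Set (Block ι) :=
  {b | b ∈ V.pending ∧ ∀ c, V.acks b c → c ∈ V.delivered}

/-- The acking node set `ANS(b)`. -/
def ansOf (V : View ι) (b : Block ι) : Set ι :=
  {j | ∃ k, (j, k) ∈ V.pending ∧ V.AcksStar (j, k) b}

/-- The global acking node set `ANS`. -/
def ans (V : View ι) : Set ι := ⋃ b ∈ V.candidates, V.ansOf b

/-- The least height of a pending block of chain `q`; used only when there is such a block. -/
noncomputable def minHeight (V : View ι) (q : ι) : ℕ := sInf {i | (q, i) ∈ V.pending}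

open Classical in
/-- The acking block-height vector `AHV(b)`, with entries in `{⊥} ∪ ℕ ∪ {∞}`, `⊥ < k < ∞`. -/
noncomputable def ahv (V : View ι) (b : Block ι) (q : ι) : WithBot ℕ∞ :=
  if q ∉ V.ans then ⊥
  else if V.AcksStar (q, V.minHeight q) b then (((V.minHeight q : ℕ) : ℕ∞) : WithBot ℕ∞)
  else ((⊤ : ℕ∞) : WithBot ℕ∞)

/-- `#AHV(b)`: the number of integer entries of `AHV(b)`. -/
noncomputable def numAHV (V : View ι) (b : Block ι) : ℕ :=
  {j | V.ahv b j ≠ ⊥ ∧ V.ahv b j ≠ ((⊤ : ℕ∞) : WithBot ℕ∞)}.ncard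

/-- `|{j : AHV(b₁)[j] < AHV(b₂)[j]}|`. -/
noncomputable def lead (V : View ι) (b₁ b₂ : Block ι) : ℕ :=
  {j | V.ahv b₁ j < V.ahv b₂ j}.ncard

open Classical in
/-- The function `Precede(b₁, b₂)`. -/
noncomputable def precede (Φ : ℕ) (V : View ι) (b₁ b₂ : Block ι) : ℤ :=
  if V.lead b₁ b₂ > Φ then 1
  else if V.lead b₂ b₁ > Φ then -1
  else 0

/-- `V'` is a possible future of the view `V` before the next output: arbitrary further blocks
(forming a partial blocklattice with the old ones) may have been received. -/
structure IsFuture (V V' : View ι) : Prop where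
  isBlocklattice : V'.toBlockGraph.IsBlocklattice
  finite : V'.blocks.Finite
  blocks_subset : V.blocks ⊆ V'.blocks
  acks_iff : ∀ b ∈ V.blocks, ∀ c, V'.acks b c ↔ V.acks b c
  delivered_eq : V'.delivered = V.delivered

open Classical in
/-- The function `Grade(b₁, b₂)`, with values `1`, `0`, `⊥`.  It is `1` if `b₁` precedes `b₂` in
every future view.  It is `0` if `b₁` leads `b₂` at present in fewer than `Φ - (n - |ANS|)` entries;
as only the `n - |ANS|` chains without a pending block can still change the comparison, `b₁` then
precedes `b₂` in no future view. -/
noncomputable def grade (Φ : ℕ) (V : View ι) (b₁ b₂ : Block ι) : WithBot ℕ :=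
  if ∀ V' : View ι, V.IsFuture V' → V'.precede Φ b₁ b₂ = 1 then 1
  else if (V.lead b₁ b₂ : ℤ) < (Φ : ℤ) - ((Nat.card ι : ℤ) - (V.ans.ncard : ℤ)) then 0
  else ⊥

/-- The preceding set `A`. -/
def precedingSet (Φ : ℕ) (V : View ι) : Set (Block ι) :=
  {b | b ∈ V.candidates ∧ ∀ b' ∈ V.candidates, V.grade Φ b' b = 0}

def InternalStability (Φ : ℕ) (V : View ι) : Prop :=
  ∀ b ∈ V.candidates \ V.precedingSet Φ, ∃ b' ∈ V.precedingSet Φ, V.grade Φ b' b = 1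

/-- External stability (a) (normal delivery). -/
def ExternalStabilityA (V : View ι) : Prop := V.ans.ncard = Nat.card ι

/-- External stability (b) (early delivery). -/
def ExternalStabilityB (Φ : ℕ) (V : View ι) : Prop :=
  (∃ b ∈ V.precedingSet Φ, V.numAHV b > Φ) ∧
    ∀ b ∈ V.precedingSet Φ, ((V.ansOf b).ncard : ℤ) ≥ (Nat.card ι : ℤ) - (Φ : ℤ)

/-- The criteria for outputting the preceding set. -/
def Criteria (Φ : ℕ) (V : View ι) : Prop :=
  V.InternalStability Φ ∧ (V.ExternalStabilityA ∨ V.ExternalStabilityB Φ)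

end View

/-- The state of a node running the total ordering algorithm: the blocks it has received, and
the sequence of sets it has output so far. -/
structure NodeState (ι : Type*) where
  received : Set (Block ι)
  outputs : List (Set (Block ι))

/-- A node starts with nothing received and nothing output. -/
def NodeState.start (ι : Type*) : NodeState ι := ⟨∅, []⟩

/-- The local view of a node whose received blocks come from the blocklattice `L`. -/
def NodeState.view {ι : Type*} (L : BlockGraph ι) (s : NodeState ι) : View ι where
  blocks := s.received
  acks := L.acks
  delivered := {b | ∃ A ∈ s.outputs, b ∈ A}

/-- The two events of the total ordering algorithm: a block of the blocklattice is received
(after all the blocks that it acks), or the criteria hold and the preceding set is output. -/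
inductive Step {ι : Type*} (L : BlockGraph ι) (Φ : ℕ) : NodeState ι → NodeState ι → Prop
  | receive (s : NodeState ι) (b : Block ι) (hb : b ∈ L.blocks) (hnew : b ∉ s.received)
      (hacks : ∀ c, L.acks b c → c ∈ s.received) :
      Step L Φ s ⟨insert b s.received, s.outputs⟩
  | output (s : NodeState ι) (h : (s.view L).Criteria Φ) :
      Step L Φ s ⟨s.received, s.outputs ++ [(s.view L).precedingSet Φ]⟩

/-- An execution of the system: the blocklattice formed by all issued blocks, the set of correct
nodes, and the state of every node over time.  Correct nodes run the total ordering algorithm,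
with arbitrary delays and orders of delivery; nothing is required of the other nodes. -/
structure Execution (ι Node : Type*) (Φ : ℕ) where
  lattice : BlockGraph ι
  isBlocklattice : lattice.IsBlocklattice
  correct : Set Node
  state : Node → ℕ → NodeState ι
  state_zero : ∀ p ∈ correct, state p 0 = NodeState.start ι
  state_succ : ∀ p ∈ correct, ∀ t,
    state p (t + 1) = state p t ∨ Step lattice Φ (state p t) (state p (t + 1))

/-- `A` is the set output by node `p` at its `i`-th output (counted from `0`). -/
def Execution.IsOutput {ι Node : Type*} {Φ : ℕ} (E : Execution ι Node Φ) (p : Node) (i : ℕ)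
    (A : Set (Block ι)) : Prop :=
  ∃ t, (E.state p t).outputs[i]? = some A

end DEXON

/-!
All chains are totally ordered, so a view whose chain `j` has a pending block has a least pending
block of that chain, and this block stays the least pending one in every future view with the same
delivered blocks.  Hence the entries of an acking block-height vector on the acking node set `ANS`
never change (`View.IsFuture.ahv_eq`), the number of leading entries of one block over another
can only grow, and by at most `n - |ANS|` (`View.IsFuture.lead_le`, `View.IsFuture.lead_le_add`).
Both kinds of external stability give `n - |ANS| ≤ Φ` (`View.Criteria.card_le`).

Let two nodes have delivered the same blocks and let both be about to output.  The union of
their views is a future of each.  Suppose that `b` is in the preceding set of the first node, and let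
`b'` be a candidate of the second one.  Then `b'` leads `b` in at most `Φ` entries in the union
(`NodeState.lead_union_le`): if the first node has `b'` as a candidate, then it grades `(b', b)` with
`0`; if not, then `b'` leads in no entry at the first node, and at most `n - |ANS| ≤ Φ` entries
are added.  This bound excludes that the second node grades `(b', b)` with `1`, and also that it
lacks `b` while `#AHV(b') > Φ`.  So by external stability `b` is a candidate of the second node
(in the case of a full `ANS` because a candidate is the least undelivered block of its chain), and
by internal stability it is in its preceding set.  By symmetry both nodes output the same set, and
induction on the number of outputs keeps the delivered blocks equal.
-/

namespace DEXON

open Relation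

/-! ### Chains and acks in a blocklattice -/

theorem BlockGraph.IsBlocklattice.mem_of_acksStar {ι : Type*} {G : BlockGraph ι}
    (hG : G.IsBlocklattice) {b c : Block ι} (hb : b ∈ G.blocks)
    (h : ReflTransGen G.acks b c) : c ∈ G.blocks := by
  induction h with
  | refl => exact hb
  | tail _ h ih => exact hG.acks_mem _ ih _ h

theorem BlockGraph.IsBlocklattice.acksStar_of_le {ι : Type*} {G : BlockGraph ι}
    (hG : G.IsBlocklattice) {j : ι} {i k : ℕ} (hik : i ≤ k) (hk : (j, k) ∈ G.blocks) :
    ReflTransGen G.acks (j, k) (j, i) := by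
  induction k, hik using Nat.le_induction with
  | base => exact .refl
  | succ k _ ih =>
    have h := hG.acks_pred j k hk
    exact .head h (ih (hG.acks_mem _ hk _ h))

theorem BlockGraph.IsBlocklattice.mem_of_le {ι : Type*} {G : BlockGraph ι}
    (hG : G.IsBlocklattice) {j : ι} {i k : ℕ} (hik : i ≤ k) (hk : (j, k) ∈ G.blocks) :
    (j, i) ∈ G.blocks :=
  hG.mem_of_acksStar hk (hG.acksStar_of_le hik hk)

/-! ### Acking block-height vectors in future views -/

namespace View

variable {ι : Type*} {V V' : View ι} {Φ : ℕ} {b b' : Block ι} {j : ι}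

theorem exists_pending_of_mem_ans (hj : j ∈ V.ans) : ∃ k, (j, k) ∈ V.pending := by
  simp only [ans, Set.mem_iUnion] at hj
  obtain ⟨b, _, k, hk, _⟩ := hj
  exact ⟨k, hk⟩

theorem minHeight_mem_pending (hj : j ∈ V.ans) : (j, V.minHeight j) ∈ V.pending :=
  Nat.sInf_mem (s := {i | (j, i) ∈ V.pending}) (exists_pending_of_mem_ans hj)

theorem ansOf_subset_ans (hb : b ∈ V.candidates) : V.ansOf b ⊆ V.ans :=
  Set.subset_biUnion_of_mem (u := V.ansOf) hb

theorem ahv_of_notMem (h : j ∉ V.ans) : V.ahv b j = ⊥ := by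
  simp [ahv, h]

theorem ahv_of_notMem_blocks (hV : V.IsBlocklattice) (hj : j ∈ V.ans) (hb : b ∉ V.blocks) :
    V.ahv b j = ((⊤ : ℕ∞) : WithBot ℕ∞) := by
  have : ¬ V.AcksStar (j, V.minHeight j) b :=
    fun h => hb (hV.mem_of_acksStar (minHeight_mem_pending hj).1 h)
  simp [ahv, hj, this]

theorem lead_eq_zero_of_notMem_blocks (hV : V.IsBlocklattice) (hb : b ∉ V.blocks) :
    V.lead b b' = 0 := by
  have : {j | V.ahv b j < V.ahv b' j} = ∅ := by
    ext j
    by_cases hj : j ∈ V.ans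
    · simp [ahv_of_notMem_blocks hV hj hb, WithBot.coe_top]
    · simp [ahv_of_notMem hj]
  rw [lead, this, Set.ncard_empty]

/-- Every integer entry of a vector is below the entry `∞` of a block that is not received. -/
theorem numAHV_le_lead [Finite ι] (hV : V.IsBlocklattice) (hb : b ∉ V.blocks) :
    V.numAHV b' ≤ V.lead b' b := by
  refine Set.ncard_le_ncard (fun j hj => ?_) (Set.toFinite _)
  obtain ⟨h1, h2⟩ := hj
  have hj : j ∈ V.ans := by
    by_contra h
    exact h1 (ahv_of_notMem h)
  rw [Set.mem_ofPred_eq, ahv_of_notMem_blocks hV hj hb]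
  rw [WithBot.coe_top] at h2 ⊢
  exact lt_top_iff_ne_top.2 h2

namespace IsFuture

theorem pending_subset (h : V.IsFuture V') : V.pending ⊆ V'.pending := fun _ hb =>
  ⟨h.blocks_subset hb.1, h.delivered_eq ▸ hb.2⟩

theorem candidates_subset (h : V.IsFuture V') : V.candidates ⊆ V'.candidates := fun b hb =>
  ⟨h.pending_subset hb.1, fun c hc => by
    rw [h.delivered_eq]
    exact hb.2 c ((h.acks_iff b hb.1.1 c).1 hc)⟩

/-- A received block acks the same blocks, directly or indirectly, in all future views. -/
theorem acksStar_iff (h : V.IsFuture V') (hV : V.IsBlocklattice) (hb : b ∈ V.blocks) :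
    V'.AcksStar b b' ↔ V.AcksStar b b' := by
  constructor <;> intro hbb'
  · induction hbb' with
    | refl => exact .refl
    | tail _ hcd ih =>
      exact ih.tail ((h.acks_iff _ (hV.mem_of_acksStar hb ih) _).1 hcd)
  · induction hbb' with
    | refl => exact .refl
    | tail hbc hcd ih =>
      exact ih.tail ((h.acks_iff _ (hV.mem_of_acksStar hb hbc) _).2 hcd)

theorem ans_subset (h : V.IsFuture V') (hV : V.IsBlocklattice) : V.ans ⊆ V'.ans := by
  intro j hj
  simp only [ans, Set.mem_iUnion] at hj ⊢
  obtain ⟨b, hb, k, hk, hkb⟩ := hj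
  exact ⟨b, h.candidates_subset hb, k, h.pending_subset hk, (h.acksStar_iff hV hk.1).2 hkb⟩

/-- The blocks of a chain below its least pending block are received and hence delivered, so the
least pending height never changes before the next output. -/
theorem minHeight_eq (h : V.IsFuture V') (hV : V.IsBlocklattice) (hj : j ∈ V.ans) :
    V'.minHeight j = V.minHeight j := by
  have hmem := minHeight_mem_pending hj
  have hmem' := minHeight_mem_pending (h.ans_subset hV hj)
  have hle : V'.minHeight j ≤ V.minHeight j := Nat.sInf_le (h.pending_subset hmem)
  refine hle.antisymm (Nat.sInf_le ⟨hV.mem_of_le hle hmem.1, ?_⟩)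
  rw [← h.delivered_eq]
  exact hmem'.2

theorem ahv_eq (h : V.IsFuture V') (hV : V.IsBlocklattice) (hj : j ∈ V.ans) :
    V'.ahv b j = V.ahv b j := by
  have hiff := h.acksStar_iff (b' := b) hV (minHeight_mem_pending hj).1
  unfold ahv
  rw [if_neg (not_not.2 hj), if_neg (not_not.2 (h.ans_subset hV hj)), h.minHeight_eq hV hj]
  by_cases hb : V.AcksStar (j, V.minHeight j) b
  · rw [if_pos hb, if_pos (hiff.2 hb)]
  · rw [if_neg hb, if_neg (mt hiff.1 hb)]

theorem lead_le [Finite ι] (h : V.IsFuture V') (hV : V.IsBlocklattice) :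
    V.lead b b' ≤ V'.lead b b' := by
  refine Set.ncard_le_ncard (fun j hlt => ?_) (Set.toFinite _)
  have hj : j ∈ V.ans := by
    by_contra hj
    simp [ahv_of_notMem hj] at hlt
  simpa only [Set.mem_ofPred_eq, h.ahv_eq hV hj] using hlt

theorem lead_le_add [Finite ι] (h : V.IsFuture V') (hV : V.IsBlocklattice) :
    V'.lead b b' ≤ V.lead b b' + (Nat.card ι - V.ans.ncard) := by
  have hsub : {j | V'.ahv b j < V'.ahv b' j} ⊆ {j | V.ahv b j < V.ahv b' j} ∪ V.ansᶜ := by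
    intro j hlt
    by_cases hj : j ∈ V.ans
    · left
      simpa only [Set.mem_ofPred_eq, h.ahv_eq hV hj] using hlt
    · exact .inr hj
  rw [← Set.ncard_compl]
  exact (Set.ncard_le_ncard hsub (Set.toFinite _)).trans (Set.ncard_union_le _ _)

theorem lt_lead_of_grade_eq_one (h : V.IsFuture V') (hg : V.grade Φ b b' = 1) :
    Φ < V'.lead b b' := by
  have hp : V'.precede Φ b b' = 1 := by
    unfold grade at hg
    split_ifs at hg with h1 h2
    · exact h1 V' h
    · exact absurd hg zero_ne_one
    · exact absurd hg WithBot.bot_ne_one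
  by_contra hlead
  unfold precede at hp
  rw [if_neg hlead] at hp
  split_ifs at hp
  exact absurd hp zero_ne_one

end IsFuture

theorem lead_add_lt_of_grade_eq_zero [Finite ι] (hg : V.grade Φ b b' = 0) :
    V.lead b b' + (Nat.card ι - V.ans.ncard) < Φ := by
  unfold grade at hg
  split_ifs at hg with h1 h2
  · exact absurd hg one_ne_zero
  · have := Set.ncard_le_card V.ans
    omega
  · exact absurd hg WithBot.bot_ne_zero

theorem Criteria.card_le [Finite ι] (h : V.Criteria Φ) : Nat.card ι - V.ans.ncard ≤ Φ := by
  obtain ⟨-, ha | ⟨⟨b, hb, -⟩, hall⟩⟩ := h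
  · rw [ha]
    omega
  · have h1 := hall b hb
    have h2 := Set.ncard_le_ncard (ansOf_subset_ans hb.1) (Set.toFinite _)
    omega

end View

/-! ### Two nodes that have delivered the same blocks -/

/-- A state that a correct node can be in: it has received finitely many blocks of the
blocklattice, its received blocks and its delivered blocks each contain all the blocks that they
ack, and every delivered block is received. -/
structure NodeState.IsConsistent {ι : Type*} (L : BlockGraph ι) (s : NodeState ι) : Prop where
  finite : s.received.Finite
  subset : s.received ⊆ L.blocks
  acks_mem : ∀ b ∈ s.received, ∀ c, L.acks b c → c ∈ s.received
  delivered_subset : (s.view L).delivered ⊆ s.received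
  delivered_acks : ∀ b ∈ (s.view L).delivered, ∀ c, L.acks b c → c ∈ (s.view L).delivered

namespace NodeState

variable {ι : Type*} {L : BlockGraph ι} {s t : NodeState ι} {Φ : ℕ} {b b' : Block ι}

/-- The state of a node that has received what either of two nodes has received, with the outputs
of the first one. -/
def union (s t : NodeState ι) : NodeState ι := ⟨s.received ∪ t.received, s.outputs⟩

theorem union_comm_of_outputs_eq (hst : s.outputs = t.outputs) : s.union t = t.union s := by
  simp only [union, hst, Set.union_comm]

theorem IsConsistent.isBlocklattice (hs : s.IsConsistent L) (hL : L.IsBlocklattice) :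
    (s.view L).IsBlocklattice where
  acks_mem := hs.acks_mem
  acks_pred j k h := hL.acks_pred j k (hs.subset h)
  acyclic b hb := hL.acyclic b (hs.subset hb)

theorem IsConsistent.union (hs : s.IsConsistent L) (ht : t.IsConsistent L) :
    (s.union t).IsConsistent L where
  finite := hs.finite.union ht.finite
  subset := Set.union_subset hs.subset ht.subset
  acks_mem b hb c hc :=
    hb.imp (fun h => hs.acks_mem b h c hc) (fun h => ht.acks_mem b h c hc)
  delivered_subset := hs.delivered_subset.trans Set.subset_union_left
  delivered_acks := hs.delivered_acks

theorem IsConsistent.isFuture_union (hs : s.IsConsistent L) (ht : t.IsConsistent L)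
    (hL : L.IsBlocklattice) : (s.view L).IsFuture ((s.union t).view L) where
  isBlocklattice := (hs.union ht).isBlocklattice hL
  finite := (hs.union ht).finite
  blocks_subset := Set.subset_union_left
  acks_iff _ _ _ := Iff.rfl
  delivered_eq := rfl

/-- With the same delivered blocks, being a candidate depends on the node only through the receipt
of the block. -/
theorem mem_candidates_of_mem_received (hst : s.outputs = t.outputs)
    (hb : b ∈ (s.view L).candidates) (ht : b ∈ t.received) : b ∈ (t.view L).candidates := by
  simp only [View.candidates, View.pending, view, hst, Set.mem_ofPred_eq, Set.mem_sdiff] at hb ⊢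
  exact ⟨⟨ht, hb.1.2⟩, hb.2⟩

/-- A candidate of one node is received by every node that has the same delivered blocks and
a pending block in its chain, since the predecessor of a candidate is delivered. -/
theorem mem_received_of_mem_ans (hL : L.IsBlocklattice) (hs : s.IsConsistent L)
    (ht : t.IsConsistent L) (hst : s.outputs = t.outputs) (hb : b ∈ (s.view L).candidates)
    (hj : b.1 ∈ (t.view L).ans) : b ∈ t.received := by
  obtain ⟨j, k⟩ := b
  obtain ⟨m, hm⟩ := View.exists_pending_of_mem_ans hj
  rcases le_or_gt k m with hkm | hmk
  · exact (ht.isBlocklattice hL).mem_of_le hkm hm.1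
  · obtain ⟨k, rfl⟩ : ∃ l, k = l + 1 := ⟨k - 1, by omega⟩
    have hk : (j, k) ∈ (s.view L).delivered := hb.2 _ (hL.acks_pred j k (hs.subset hb.1.1))
    have hD : ∀ {c}, ReflTransGen L.acks (j, k) c → c ∈ (s.view L).delivered := by
      intro c hc
      induction hc with
      | refl => exact hk
      | tail _ h ih => exact hs.delivered_acks _ ih _ h
    have hmD := hD (hL.acksStar_of_le (Nat.le_of_lt_succ hmk)
      (hs.subset (hs.delivered_subset hk)))
    refine absurd ?_ hm.2
    simpa only [view, hst] using hmD

/-- In the union of two views, no candidate of the second node precedes a block in the preceding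
set of the first. -/
theorem lead_union_le [Finite ι] (hL : L.IsBlocklattice) (hs : s.IsConsistent L)
    (ht : t.IsConsistent L) (hst : s.outputs = t.outputs) (hcs : (s.view L).Criteria Φ)
    (hb : b ∈ (s.view L).precedingSet Φ) (hb' : b' ∈ (t.view L).candidates) :
    ((s.union t).view L).lead b' b ≤ Φ := by
  have hle := (hs.isFuture_union ht hL).lead_le_add (b := b') (b' := b) (hs.isBlocklattice hL)
  by_cases hmem : b' ∈ s.received
  · have := View.lead_add_lt_of_grade_eq_zero
      (hb.2 b' (mem_candidates_of_mem_received hst.symm hb' hmem))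
    omega
  · have h0 : (s.view L).lead b' b = 0 :=
      View.lead_eq_zero_of_notMem_blocks (hs.isBlocklattice hL) hmem
    have := hcs.card_le
    omega

theorem precedingSet_subset [Finite ι] (hL : L.IsBlocklattice) (hs : s.IsConsistent L)
    (ht : t.IsConsistent L) (hst : s.outputs = t.outputs) (hcs : (s.view L).Criteria Φ)
    (hct : (t.view L).Criteria Φ) :
    (s.view L).precedingSet Φ ⊆ (t.view L).precedingSet Φ := by
  intro b hb
  have hfut : (t.view L).IsFuture ((s.union t).view L) := by
    rw [union_comm_of_outputs_eq hst]
    exact ht.isFuture_union hs hL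
  have hbt : b ∈ t.received := by
    rcases hct.2 with ha | ⟨⟨b', hb', hnum⟩, -⟩
    · have huniv : (t.view L).ans = Set.univ := Set.eq_univ_iff_ncard _ |>.2 ha
      exact mem_received_of_mem_ans hL hs ht hst hb.1 (huniv ▸ Set.mem_univ _)
    · by_contra hbt
      have h1 : (t.view L).numAHV b' ≤ (t.view L).lead b' b :=
        View.numAHV_le_lead (ht.isBlocklattice hL) hbt
      have h2 := hfut.lead_le (b := b') (b' := b) (ht.isBlocklattice hL)
      have h3 := lead_union_le hL hs ht hst hcs hb hb'.1
      omega
  by_contra hnot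
  obtain ⟨b', hb', hg⟩ := hct.1 b ⟨mem_candidates_of_mem_received hst hb.1 hbt, hnot⟩
  exact (hfut.lt_lead_of_grade_eq_one hg).not_ge (lead_union_le hL hs ht hst hcs hb hb'.1)

/-! ### Executions -/

/-- `A` is a set that a consistent node outputs, with the criteria satisfied, right after the
outputs `l`. -/
def IsNextOutput (L : BlockGraph ι) (Φ : ℕ) (l : List (Set (Block ι))) (A : Set (Block ι)) :
    Prop :=
  ∃ s : NodeState ι, s.IsConsistent L ∧ s.outputs = l ∧ (s.view L).Criteria Φ ∧
    (s.view L).precedingSet Φ = A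

theorem IsNextOutput.unique [Finite ι] (hL : L.IsBlocklattice) {l : List (Set (Block ι))}
    {A B : Set (Block ι)} (hA : IsNextOutput L Φ l A) (hB : IsNextOutput L Φ l B) : A = B := by
  obtain ⟨s, hs, hsl, hcs, rfl⟩ := hA
  obtain ⟨t, ht, htl, hct, rfl⟩ := hB
  exact (precedingSet_subset hL hs ht (hsl.trans htl.symm) hcs hct).antisymm
    (precedingSet_subset hL ht hs (htl.trans hsl.symm) hct hcs)

theorem isConsistent_start : (start ι).IsConsistent L := by
  constructor <;> simp [start, view]

theorem IsConsistent.step (hs : s.IsConsistent L) (h : Step L Φ s t) : t.IsConsistent L := by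
  cases h with
  | receive b hb hnew hacks =>
    refine ⟨hs.finite.insert b, Set.insert_subset hb hs.subset, ?_,
      hs.delivered_subset.trans (Set.subset_insert _ _), hs.delivered_acks⟩
    rintro c (rfl | hc) d hd
    · exact .inr (hacks d hd)
    · exact .inr (hs.acks_mem c hc d hd)
  | output hc =>
    have hD : (view L ⟨s.received, s.outputs ++ [(s.view L).precedingSet Φ]⟩).delivered =
        (s.view L).delivered ∪ (s.view L).precedingSet Φ := by
      ext b
      simp [view, or_and_right, exists_or]
    refine ⟨hs.finite, hs.subset, hs.acks_mem, ?_, ?_⟩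
    · rw [hD]
      exact Set.union_subset hs.delivered_subset fun b hb => hb.1.1.1
    · rw [hD]
      rintro b (hb | hb) c hbc
      · exact .inl (hs.delivered_acks b hb c hbc)
      · exact .inl (hb.1.2 c hbc)

end NodeState

namespace Execution

variable {ι Node : Type*} {Φ : ℕ} (E : Execution ι Node Φ) {p : Node}

theorem isConsistent_state (hp : p ∈ E.correct) (t : ℕ) :
    (E.state p t).IsConsistent E.lattice := by
  induction t with
  | zero =>
    rw [E.state_zero p hp]
    exact NodeState.isConsistent_start
  | succ t ih =>
    rcases E.state_succ p hp t with h | h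
    · rwa [h]
    · exact ih.step h

theorem isNextOutput_take (hp : p ∈ E.correct) (t i : ℕ) {A : Set (Block ι)}
    (hA : (E.state p t).outputs[i]? = some A) :
    NodeState.IsNextOutput E.lattice Φ ((E.state p t).outputs.take i) A := by
  induction t with
  | zero => simp [E.state_zero p hp, NodeState.start] at hA
  | succ t ih =>
    have hcons := E.isConsistent_state hp t
    rcases E.state_succ p hp t with h | h
    · rw [h] at hA ⊢
      exact ih hA
    · generalize E.state p (t + 1) = s' at h hA ⊢
      cases h with
      | receive b hb hnew hacks => exact ih hA
      | output hc =>
        rcases lt_trichotomy i (E.state p t).outputs.length with hi | hi | hi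
        · rw [List.getElem?_append_left hi] at hA
          rw [List.take_append_of_le_length hi.le]
          exact ih hA
        · subst hi
          simp only [List.getElem?_concat_length, Option.some.injEq] at hA
          exact ⟨E.state p t, hcons, by simp, hc, hA⟩
        · rw [List.getElem?_eq_none (by simp; omega)] at hA
          cases hA

end Execution

end DEXON

theorem mainTheorem2 {ι Node : Type*} [Finite ι] (Φ : ℕ)
    (hΦ : (Nat.card ι < 2 * Φ ∧ Φ ≤ Nat.card ι) ∨ Φ = 2 * ((Nat.card ι - 1) / 3) + 1)
    (E : DEXON.Execution ι Node Φ) (p q : Node) (hp : p ∈ E.correct) (hq : q ∈ E.correct)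
    (i : ℕ) (A_p A_q : Set (DEXON.Block ι))
    (hA_p : E.IsOutput p i A_p) (hA_q : E.IsOutput q i A_q) :
    A_p = A_q := by
  obtain ⟨t, ht⟩ := hA_p
  obtain ⟨u, hu⟩ := hA_q
  induction i using Nat.strong_induction_on generalizing A_p A_q with
  | _ i ih =>
    have htake : (E.state p t).outputs.take i = (E.state q u).outputs.take i := by
      refine List.ext_getElem? fun m => ?_
      rcases lt_or_ge m i with hm | hm
      · rw [List.getElem?_take_of_lt hm, List.getElem?_take_of_lt hm]
        obtain ⟨hit, -⟩ := List.getElem?_eq_some_iff.1 ht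
        obtain ⟨hiu, -⟩ := List.getElem?_eq_some_iff.1 hu
        have h1 := List.getElem?_eq_getElem (hm.trans hit)
        have h2 := List.getElem?_eq_getElem (hm.trans hiu)
        rw [h1, h2, ih m hm _ _ h1 h2]
      · rw [List.getElem?_take_eq_none hm, List.getElem?_take_eq_none hm]
    have hnext := E.isNextOutput_take hp t i ht
    rw [htake] at hnext
    exact hnext.unique E.isBlocklattice (E.isNextOutput_take hq u i hu)
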